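/- For $n\ge 1$ let $\mathrm{MAJ}_n:\{0,1\}^n\to\{0,1\}$ be the majority function, $\mathrm{MAJ}_n(x)=1$ if and only if $\sum_{i=1}^n x_i\ge n/2$. A (loose) permutation branching program on $n$ bits of width $k$ consists of a source node, two sinks labelled accept and reject, $l\ge 0$ query layers of $k$ nodes each, and a bottom layer of $k$ dummy nodes below the last query layer. The source and every query layer are each labelled by a variable $x_i$, which is queried by the source, respectively by all nodes of the layer. The source and every node of a query layer have one outgoing edge labelled $0$ and one labelled $1$, each leading to a node of the next layer or directly to a sink, and for every query layer and every $b\in\{0,1\}$ the edges labelled $b$ out of that layer form an injective map from $\{1,\dots,k\}$ to $\{1,\dots,k\}\cup\{\text{accept},\text{reject}\}$. On input $x$ one starts at the source and follows at each node the edge labelled with the value of the queried variable. The program computes $f:\{0,1\}^n\to\{0,1\}$ if every $x$ with $f(x)=1$ ends at accept and every $x$ with $f(x)=0$ ends at reject (so that no input ends at a dummy node). Its size is its total number of nodes, $(l+1)k+3$, and $\mathrm{PBP}(f)$ is the minimal size of a permutation branching program computing $f$. Then $\mathrm{PBP}(\mathrm{MAJ}_n)=O(n\log^3 n)$: there is a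 constant $C>0$ such that for every $n\ge 2$ the function $\mathrm{MAJ}_n$ is computed by some permutation branching program and $\mathrm{PBP}(\mathrm{MAJ}_n)\le C\,n\log^3 n$. -/

import Mathlib

/-- One query layer, with `k` nodes, of a (loose) permutation branching program on `n` bits.
All nodes of the layer query the variable `var`; `edge b v` is the end point of the edge
labelled `b` out of node `v`: either a node `Sum.inl w` of the next layer, or one of the two
sinks, `Sum.inr true` (accept) and `Sum.inr false` (reject). For each value `b` of the queried
variable the edges form an injective map `{1,…,k} → {1,…,k} ∪ {accept, reject}`. -/
structure PBPLayer (n k : ℕ) where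
  var : Fin n
  edge : Bool → Fin k → Fin k ⊕ Bool
  injective_edge : ∀ b, Function.Injective (edge b)

/-- The end point of the step made on input `x` at this layer; a computation that has already
arrived at a sink stays there. -/
def PBPLayer.step {n k : ℕ} (L : PBPLayer n k) (x : Fin n → Bool) : Fin k ⊕ Bool → Fin k ⊕ Bool
  | Sum.inl v => L.edge (x L.var) v
  | Sum.inr a => Sum.inr a

/-- A (loose) permutation branching program on `n` bits: a source node, followed by query layers
of `width` nodes each. Below the last query layer there are the two sinks and `width` dummy nodes,
which give the injective edge maps of the last query layer their room; a computation that ends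
in a dummy node gives no answer (see `PermBP.Computes`). -/
structure PermBP (n : ℕ) where
  width : ℕ
  sourceVar : Fin n
  sourceEdge : Bool → Fin width ⊕ Bool
  layers : List (PBPLayer n width)

namespace PermBP

variable {n : ℕ}

/-- The node at which the computation on input `x` ends. -/
def result (P : PermBP n) (x : Fin n → Bool) : Fin P.width ⊕ Bool :=
  P.layers.foldl (fun s L => L.step x s) (P.sourceEdge (x P.sourceVar))

/-- `P` computes `f`: every input with `f x = 1` arrives at the sink accept, and every input with
`f x = 0` arrives at the sink reject. -/
def Computes (P : PermBP n) (f : (Fin n → Bool) → Bool) : Prop :=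
  ∀ x, P.result x = Sum.inr (f x)

/-- The number of nodes: the source, `width` nodes in each query layer, the `width` dummy nodes of
the bottom layer, and the two sinks. -/
def size (P : PermBP n) : ℕ :=
  1 + (P.layers.length + 1) * P.width + 2

end PermBP

/-- `PBP(f)`: the minimal size of a permutation branching program that computes `f`
(`⊤` if there is none). -/
noncomputable def pbpComplexity {n : ℕ} (f : (Fin n → Bool) → Bool) : ℕ∞ :=
  ⨅ (P : PermBP n) (_ : P.Computes f), (P.size : ℕ∞)

/-- The majority function on `n` bits: `MAJ(x) = 1` iff `∑ i, x i ≥ n / 2`. -/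
noncomputable def majority (n : ℕ) (x : Fin n → Bool) : Bool :=
  decide ((n : ℚ) / 2 ≤ ∑ i, if x i then 1 else 0)

/-!
Let `s` be the number of ones of the input and `T = ⌈n / 2⌉`. The program works in about `log n`
rounds. Each of them starts at the same node and knows the range of `|s - T + 1 / 2|` up to a power
of two; it either answers or halves the range (`exists_layers_threshold`). After the last round the
range is empty, so every input has been answered.

In a round the node is a point of a circle, which is to be turned by `α s`, where `1 / α` is about
four to eight times the range. Then counts whose end points agree differ by at most half the range,
so an end point reached by some count of the outer half of the range can safely be sent to a sink
(`exists_separating_sweeps`). The other computations undo the turn by the inverse permutations and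
are back at the starting node (`runLayers_round`).

A turn by `α s` is not available directly on a circle of `O(log n)` nodes, since `α` may be as small
as `1 / n`. But a circle of `M` nodes can be turned by `c s / M` exactly, by a sweep over the
variables, and the identity of nodes takes a circle of `M` nodes to one of `M + 1` nodes with an
error of at most `1 / (M + 1)` of a turn. Running through `R` consecutive moduli from `m = 16 R` on,
the total error is at most `1 / 16` (`sweepEnd_rotations`), and the angles `∑ i, c i / (m + i)`
include all integer multiples of the `(R - 1)`-st finite difference of `1 / y` at `m`, which
is at most `2 ^ (1 - R)` (`exists_sum_div_eq`, `exists_sum_div_mem`). So `R = O(log n)` suffices: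
there are `O(log n)` rounds of `O(log n)` sweeps of `n` layers of width `17 R = O(log n)`.
-/

/-! ### Sweeps, exits and rounds of a program -/

/-- The number of ones of `x`. -/
def onesCount {n : ℕ} (x : Fin n → Bool) : ℕ := (List.finRange n).countP x

/-- The layer reading `x t` that applies the permutation `σ` if `x t = 1`. -/
def permLayer {n k : ℕ} (σ : Equiv.Perm (Fin k)) (t : Fin n) : PBPLayer n k where
  var := t
  edge b v := Sum.inl (if b then σ v else v)
  injective_edge b := by
    cases b
    · intro v w h
      simpa using h
    · intro v w h
      simpa using h

/-- For each permutation of the list, a sweep over all variables that applies it once for every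
one of the input. -/
def sweeps (n : ℕ) {k : ℕ} (ps : List (Equiv.Perm (Fin k))) : List (PBPLayer n k) :=
  ps.flatMap fun σ => (List.finRange n).map (permLayer σ)

/-- The node to which the sweeps `ps` take the node `v` on an input with `s` ones. -/
def sweepEnd {k : ℕ} (ps : List (Equiv.Perm (Fin k))) (s : ℕ) (v : Fin k) : Fin k :=
  ps.foldl (fun w σ => (σ ^ s) w) v

/-- Where a node with the given verdict leads: to the sink it names, or nowhere. -/
def verdictEnd {k : ℕ} (f : Fin k → Option Bool) (v : Fin k) : Fin k ⊕ Bool :=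
  (f v).elim (Sum.inl v) Sum.inr

/-- The layer that sends the node `v` to the sink `f v`, if there is one, and fixes all other
nodes; it ignores the variable `t` that it reads. -/
def exitLayer {n k : ℕ} (t : Fin n) (f : Fin k → Option Bool) (v : Fin k) : PBPLayer n k where
  var := t
  edge _ w := if w = v then verdictEnd f v else Sum.inl w
  injective_edge _ := by
    intro w w' h
    unfold verdictEnd at h
    cases hf : f v <;> by_cases h1 : w = v <;> by_cases h2 : w' = v <;> simp_all

/-- The final node of the computation on `x` that passes through `Ls` from `p`. -/
def runLayers {n k : ℕ} (Ls : List (PBPLayer n k)) (x : Fin n → Bool) (p : Fin k ⊕ Bool) :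
    Fin k ⊕ Bool :=
  Ls.foldl (fun q L => L.step x q) p

section Layers

variable {n k : ℕ}

theorem runLayers_append (Ls Ls' : List (PBPLayer n k)) (x : Fin n → Bool) (p : Fin k ⊕ Bool) :
    runLayers (Ls ++ Ls') x p = runLayers Ls' x (runLayers Ls x p) :=
  List.foldl_append

theorem runLayers_inr (Ls : List (PBPLayer n k)) (x : Fin n → Bool) (a : Bool) :
    runLayers Ls x (Sum.inr a) = Sum.inr a := by
  induction Ls with
  | nil => rfl
  | cons L Ls ih => exact ih

theorem runLayers_map_permLayer (σ : Equiv.Perm (Fin k)) (l : List (Fin n)) (x : Fin n → Bool)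
    (v : Fin k) :
    runLayers (l.map (permLayer σ)) x (Sum.inl v) = Sum.inl ((σ ^ l.countP x) v) := by
  induction l generalizing v with
  | nil => rfl
  | cons t l ih =>
    have h : runLayers ((t :: l).map (permLayer σ)) x (Sum.inl v)
        = runLayers (l.map (permLayer σ)) x (Sum.inl (if x t then σ v else v)) := rfl
    rw [h, ih]
    cases hx : x t <;> simp [hx, pow_succ]

theorem runLayers_sweeps (ps : List (Equiv.Perm (Fin k))) (x : Fin n → Bool) (v : Fin k) :
    runLayers (sweeps n ps) x (Sum.inl v) = Sum.inl (sweepEnd ps (onesCount x) v) := by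
  induction ps generalizing v with
  | nil => rfl
  | cons σ ps ih =>
    have h : sweeps n (σ :: ps) = (List.finRange n).map (permLayer σ) ++ sweeps n ps := rfl
    rw [h, runLayers_append, runLayers_map_permLayer, ih]
    rfl

theorem length_sweeps (ps : List (Equiv.Perm (Fin k))) :
    (sweeps n ps).length = ps.length * n := by
  simp [sweeps, List.length_flatMap]

theorem sweepEnd_inverse (ps : List (Equiv.Perm (Fin k))) (s : ℕ) (v : Fin k) :
    sweepEnd (ps.map (·⁻¹)).reverse s (sweepEnd ps s v) = v := by
  induction ps generalizing v with
  | nil => rfl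
  | cons σ ps ih =>
    have h : sweepEnd (σ :: ps) s v = sweepEnd ps s ((σ ^ s) v) := rfl
    have h' := ih ((σ ^ s) v)
    unfold sweepEnd at h h' ⊢
    rw [h, List.map_cons, List.reverse_cons, List.foldl_append, h']
    simp

theorem runLayers_map_exitLayer (t : Fin n) (f : Fin k → Option Bool) (l : List (Fin k))
    (x : Fin n → Bool) (v : Fin k) :
    runLayers (l.map (exitLayer t f)) x (Sum.inl v)
      = if v ∈ l then verdictEnd f v else Sum.inl v := by
  induction l with
  | nil => rfl
  | cons w l ih =>
    have h : runLayers ((w :: l).map (exitLayer t f)) x (Sum.inl v)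
        = runLayers (l.map (exitLayer t f)) x
            (if v = w then verdictEnd f w else Sum.inl v) := rfl
    rw [h]
    by_cases hv : v = w
    · subst hv
      cases hf : f v with
      | none => simp [verdictEnd, hf] at ih ⊢; exact ih
      | some a => simp [verdictEnd, hf, runLayers_inr]
    · simp [hv, ih]

/-- Sweep, leave for a sink where the node reached has a verdict, and undo the sweeps otherwise:
a computation that stays inside the program is back at its start. -/
theorem runLayers_round (t : Fin n) (ps : List (Equiv.Perm (Fin k))) (f : Fin k → Option Bool)
    (x : Fin n → Bool) (v : Fin k) :
    runLayers (sweeps n ps ++ (List.finRange k).map (exitLayer t f) ++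
        sweeps n (ps.map (·⁻¹)).reverse) x (Sum.inl v)
      = (f (sweepEnd ps (onesCount x) v)).elim (Sum.inl v) Sum.inr := by
  rw [runLayers_append, runLayers_append, runLayers_sweeps, runLayers_map_exitLayer]
  simp only [List.mem_finRange, if_true, verdictEnd]
  cases f (sweepEnd ps (onesCount x) v) with
  | none => simp only [Option.elim]; rw [runLayers_sweeps, sweepEnd_inverse]
  | some a => exact runLayers_inr _ _ _

end Layers

/-! ### Approximate rotation by small angles -/

/-- The rotation by `c` of the first `M` of `k` nodes, with its powers. -/
theorem exists_rotation {k M : ℕ} (hM : 0 < M) (hMk : M ≤ k) (c : ℤ) :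
    ∃ σ : Equiv.Perm (Fin k), ∀ (s : ℕ) (v : Fin k), (v : ℕ) < M →
      ((σ ^ s) v : ℕ) < M ∧ ∃ N : ℤ, (((σ ^ s) v : ℕ) : ℤ) = (v : ℕ) + s * c + N * M := by
  have hM' : (0 : ℤ) < M := by exact_mod_cast hM
  have hlt (d : ℤ) : (d % M).toNat < M := by
    have := Int.emod_lt_of_pos d hM'
    have := Int.emod_nonneg d hM'.ne'
    omega
  let g (d : ℤ) (v : Fin k) : Fin k :=
    if (v : ℕ) < M then ⟨(((v : ℕ) + d) % M).toNat, (hlt _).trans_le hMk⟩ else v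
  have hg (d : ℤ) (v : Fin k) (hv : (v : ℕ) < M) :
      (g d v : ℕ) < M ∧ ((g d v : ℕ) : ℤ) = ((v : ℕ) + d) % M := by
    have := Int.emod_nonneg ((v : ℕ) + d) hM'.ne'
    simp only [g, hv, if_true]
    exact ⟨hlt _, Int.toNat_of_nonneg this⟩
  have hinv (d : ℤ) (v : Fin k) : g (-d) (g d v) = v := by
    by_cases hv : (v : ℕ) < M
    · obtain ⟨h1, h2⟩ := hg d v hv
      obtain ⟨-, h4⟩ := hg (-d) (g d v) h1
      apply Fin.ext
      have h5 : (((v : ℕ) + d) % M + -d) % (M : ℤ) = (v : ℕ) := by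
        rw [Int.emod_add_emod, add_neg_cancel_right]
        exact Int.emod_eq_of_lt (by omega) (by omega)
      rw [h2, h5] at h4
      exact_mod_cast h4
    · simp [g, hv]
  refine ⟨⟨g c, g (-c), hinv c, fun v => by simpa using hinv (-c) v⟩, fun s v hv => ?_⟩
  induction s with
  | zero => exact ⟨hv, 0, by simp⟩
  | succ s ih =>
    obtain ⟨h1, N, hN⟩ := ih
    obtain ⟨h2, h3⟩ := hg c _ h1
    rw [pow_succ']
    refine ⟨h2, N - ((v : ℕ) + s * c + N * M + c) / M, ?_⟩
    refine h3.trans ?_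
    rw [hN, Int.emod_def]
    push_cast
    ring

/-- The `r`-th finite difference of `1 / y` at `m`: the reciprocals of `m, …, m + r` have a tiny
integer combination. -/
theorem exists_sum_div_eq (r m : ℕ) (hm : 0 < m) :
    ∃ c : ℕ → ℤ, ∑ i ∈ Finset.range (r + 1), (c i : ℝ) / (m + i : ℕ)
      = (r.factorial : ℝ) / m.ascFactorial (r + 1) := by
  induction r generalizing m with
  | zero => exact ⟨fun _ => 1, by simp [Nat.ascFactorial]⟩
  | succ r ih =>
    obtain ⟨c, hc⟩ := ih m hm
    obtain ⟨d, hd⟩ := ih (m + 1) m.succ_pos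
    refine ⟨fun i => (if i ≤ r then c i else 0) - (if i = 0 then 0 else d (i - 1)), ?_⟩
    have h1 : ∑ i ∈ Finset.range (r + 1 + 1), (((if i ≤ r then c i else 0 : ℤ)) : ℝ) / (m + i : ℕ)
        = (r.factorial : ℝ) / m.ascFactorial (r + 1) := by
      rw [Finset.sum_range_succ, ← hc]
      simp only [Nat.not_succ_le_self, if_false, Int.cast_zero, zero_div, add_zero]
      refine Finset.sum_congr rfl fun i hi => ?_
      rw [if_pos (Nat.lt_succ_iff.mp (Finset.mem_range.mp hi))]
    have h2 : ∑ i ∈ Finset.range (r + 1 + 1),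
        (((if i = 0 then 0 else d (i - 1) : ℤ)) : ℝ) / (m + i : ℕ)
        = (r.factorial : ℝ) / (m + 1).ascFactorial (r + 1) := by
      rw [Finset.sum_range_succ', ← hd]
      simp [add_assoc, add_comm (1 : ℝ)]
    simp only [Int.cast_sub, sub_div, Finset.sum_sub_distrib]
    rw [h1, h2]
    have e1 : m.ascFactorial (r + 1) = m * (m + 1).ascFactorial r := by
      rw [Nat.succ_ascFactorial, Nat.ascFactorial_succ]
    have e2 : (m + 1).ascFactorial (r + 1) = (m + 1 + r) * (m + 1).ascFactorial r :=
      Nat.ascFactorial_succ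
    have e3 : m.ascFactorial (r + 1 + 1) = (m + 1 + r) * (m * (m + 1).ascFactorial r) := by
      rw [Nat.ascFactorial_succ, e1]; ring
    have hP : ((m + 1).ascFactorial r : ℝ) ≠ 0 := by
      exact_mod_cast (Nat.ascFactorial_pos m r).ne'
    have hm' : (m : ℝ) ≠ 0 := by exact_mod_cast hm.ne'
    have hmr : (m + 1 + r : ℝ) ≠ 0 := by positivity
    rw [e1, e2, e3, Nat.factorial_succ]
    push_cast
    field_simp
    ring

theorem factorial_mul_two_pow_le_ascFactorial (r m : ℕ) (hm : 0 < m) (hr : r ≤ m) :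
    r.factorial * 2 ^ r ≤ m.ascFactorial (r + 1) := by
  induction r with
  | zero => simpa [Nat.ascFactorial] using Nat.succ_le_of_lt hm
  | succ r ih =>
    rw [Nat.ascFactorial_succ, Nat.factorial_succ]
    calc (r + 1) * r.factorial * 2 ^ (r + 1) = (2 * (r + 1)) * (r.factorial * 2 ^ r) := by ring
      _ ≤ (m + (r + 1)) * m.ascFactorial (r + 1) := Nat.mul_le_mul (by omega) (ih (by omega))

/-- Every frequency scale `1 / 2 ^ j` with `j + 2 ≤ r` is reached by an integer combination of the
reciprocals of `m, …, m + r`. -/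
theorem exists_sum_div_mem (r m j : ℕ) (hm : 0 < m) (hr : r ≤ m) (hj : j + 2 ≤ r) :
    ∃ c : ℕ → ℤ,
      1 / 8 ≤ 2 ^ j * ∑ i ∈ Finset.range (r + 1), (c i : ℝ) / (m + i : ℕ) ∧
      2 ^ j * ∑ i ∈ Finset.range (r + 1), (c i : ℝ) / (m + i : ℕ) ≤ 1 / 4 := by
  obtain ⟨c, hc⟩ := exists_sum_div_eq r m hm
  set β : ℝ := (r.factorial : ℝ) / m.ascFactorial (r + 1) with hβ
  have hA : (0 : ℝ) < m.ascFactorial (r + 1) := by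
    have := factorial_mul_two_pow_le_ascFactorial r m hm hr
    have h0 : 0 < r.factorial * 2 ^ r := by positivity
    exact_mod_cast h0.trans_le this
  have hβ0 : 0 < β := by positivity
  have hβ1 : β * 2 ^ r ≤ 1 := by
    rw [hβ, div_mul_eq_mul_div, div_le_one hA]
    exact_mod_cast factorial_mul_two_pow_le_ascFactorial r m hm hr
  have hβ2 : β * (4 * 2 ^ j) ≤ 1 := by
    refine le_trans ?_ hβ1
    have : (2 : ℝ) ^ (j + 2) ≤ 2 ^ r := pow_le_pow_right₀ one_le_two hj
    rw [pow_add] at this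
    gcongr
    linarith
  -- Scale the combination by the largest integer that keeps it at most `1 / (4 * 2 ^ j)`.
  set y : ℝ := β * (4 * 2 ^ j) with hy
  have hy0 : 0 < y := by positivity
  have ha : 1 ≤ ⌊1 / y⌋ := by
    rw [Int.le_floor, le_div_iff₀ hy0]
    simpa using hβ2
  have ha1 : (1 : ℝ) ≤ ⌊1 / y⌋ := by exact_mod_cast ha
  have ha2 : (⌊1 / y⌋ : ℝ) * y ≤ 1 := (le_div_iff₀ hy0).mp (Int.floor_le _)
  have ha3 : 1 < ((⌊1 / y⌋ : ℝ) + 1) * y := (div_lt_iff₀ hy0).mp (Int.lt_floor_add_one _)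
  have hsum : 2 ^ j * ∑ i ∈ Finset.range (r + 1), (((⌊1 / y⌋ * c i : ℤ)) : ℝ) / (m + i : ℕ)
      = ⌊1 / y⌋ * y / 4 := by
    have : ∑ i ∈ Finset.range (r + 1), (((⌊1 / y⌋ * c i : ℤ)) : ℝ) / (m + i : ℕ)
        = ⌊1 / y⌋ * β := by
      rw [← hc, Finset.mul_sum]
      refine Finset.sum_congr rfl fun i _ => ?_
      push_cast
      ring
    rw [this, hy]
    ring
  refine ⟨fun i => ⌊1 / y⌋ * c i, ?_, ?_⟩
  · rw [hsum]
    nlinarith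
  · rw [hsum]
    linarith

/-- Sweeps that rotate circles of `m, m + 1, …` nodes by multiples of `s` accumulate the multiple
`s * ∑ i, c i / (m + i)` modulo `1`. Passing from the circle of `M` nodes to that of `M + 1` nodes
by the identity changes the fraction of the circle by at most `1 / (M + 1)`. -/
theorem sweepEnd_rotations {k m R : ℕ} (hm : 0 < m) (c : ℕ → ℤ) (σ : ℕ → Equiv.Perm (Fin k))
    (hσ : ∀ i < R, ∀ (s : ℕ) (v : Fin k), (v : ℕ) < m + i → ((σ i ^ s) v : ℕ) < m + i ∧
      ∃ N : ℤ, (((σ i ^ s) v : ℕ) : ℤ) = (v : ℕ) + s * c i + N * (m + i : ℕ))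
    (v : Fin k) (hv : (v : ℕ) = 0) (s i : ℕ) (hi : i ≤ R) :
    (sweepEnd ((List.range i).map σ) s v : ℕ) < m + i ∧
      ∃ (N : ℤ) (E : ℝ), 0 ≤ E ∧ E ≤ i / m ∧
        ((sweepEnd ((List.range i).map σ) s v : ℕ) : ℝ) / (m + i : ℕ)
          = s * ∑ t ∈ Finset.range i, (c t : ℝ) / (m + t : ℕ) - E + N := by
  induction i with
  | zero => exact ⟨by simpa [sweepEnd, hv] using hm, 0, 0, by simp [sweepEnd, hv]⟩
  | succ i ih =>
    obtain ⟨hlt, N, E, hE0, hE1, hE⟩ := ih (by omega)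
    have hstep : sweepEnd ((List.range (i + 1)).map σ) s v
        = (σ i ^ s) (sweepEnd ((List.range i).map σ) s v) := by
      simp [sweepEnd, List.range_succ]
    obtain ⟨hlt', N', hN'⟩ := hσ i (by omega) s _ hlt
    rw [hstep]
    set p := (sweepEnd ((List.range i).map σ) s v : ℕ)
    set q := ((σ i ^ s) (sweepEnd ((List.range i).map σ) s v) : ℕ)
    have hq : (q : ℝ) = p + s * c i + N' * (m + i : ℕ) := by exact_mod_cast hN'
    have hmR : (0 : ℝ) < m := by exact_mod_cast hm
    have hM : (0 : ℝ) < (m + i : ℕ) := by exact_mod_cast (by omega : 0 < m + i)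
    have hM1 : ((m + (i + 1) : ℕ) : ℝ) = (m + i : ℕ) + 1 := by push_cast; ring
    have hmM : (m : ℝ) ≤ (m + i : ℕ) := by exact_mod_cast Nat.le_add_right m i
    have hqM : (q : ℝ) ≤ (m + i : ℕ) := by exact_mod_cast hlt'.le
    set M : ℝ := ((m + i : ℕ) : ℝ)
    refine ⟨by omega, N + N', E + q / (M * (M + 1)), by positivity, ?_, ?_⟩
    · have : q / (M * (M + 1)) ≤ 1 / m := by
        rw [div_le_div_iff₀ (by positivity) hmR]
        nlinarith
      push_cast
      rw [add_div]
      linarith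
    · have h1 : (q : ℝ) / (M + 1) = q / M - q / (M * (M + 1)) := by
        field_simp
        ring
      have h2 : (q : ℝ) / M = p / M + s * (c i / M) + N' := by
        rw [hq]
        field_simp
      rw [hM1, h1, h2, hE, Finset.sum_range_succ, Int.cast_add]
      ring

/-! ### Halving the range of the count -/

/-- Sweeps whose end point separates counts at the scale `2 ^ j`: among counts closer than
`2 * 2 ^ j`, those with the same end point are at most `2 ^ j / 2` apart. -/
theorem exists_separating_sweeps (r j : ℕ) (hj : j + 2 ≤ r) (v : Fin (17 * (r + 1)))
    (hv : (v : ℕ) = 0) :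
    ∃ ps : List (Equiv.Perm (Fin (17 * (r + 1)))), ps.length = r + 1 ∧
      ∀ s s' : ℕ, |(s : ℤ) - s'| < 2 * 2 ^ j → sweepEnd ps s v = sweepEnd ps s' v →
        2 * |(s : ℤ) - s'| ≤ 2 ^ j := by
  obtain ⟨c, hα1, hα2⟩ := exists_sum_div_mem r (16 * (r + 1)) j (by omega) (by omega) hj
  choose! σ hσ using fun (i : ℕ) (hi : i < r + 1) =>
    exists_rotation (k := 17 * (r + 1)) (M := 16 * (r + 1) + i) (by omega) (by omega) (c i)
  refine ⟨(List.range (r + 1)).map σ, by simp, fun s s' hs hend => ?_⟩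
  have key (u : ℕ) := (sweepEnd_rotations (by omega) c σ hσ v hv u (r + 1) le_rfl).2
  obtain ⟨N, E, hE0, hE1, hE⟩ := key s
  obtain ⟨N', E', hE0', hE1', hE'⟩ := key s'
  rw [hend, hE'] at hE
  set α : ℝ := ∑ i ∈ Finset.range (r + 1), (c i : ℝ) / (16 * (r + 1) + i : ℕ)
  have hδ : ((r + 1 : ℕ) : ℝ) / (16 * (r + 1) : ℕ) = 1 / 16 := by
    push_cast
    field_simp
  rw [hδ] at hE1 hE1'
  have h2j : (0 : ℝ) < 2 ^ j := by positivity
  have hα0 : 0 < α := by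
    by_contra h
    nlinarith
  have hsR : |(s : ℝ) - s'| < 2 * 2 ^ j := by exact_mod_cast hs
  have habs : |α * ((s : ℝ) - s')| = α * |(s : ℝ) - s'| := by rw [abs_mul, abs_of_pos hα0]
  have hαs : |α * ((s : ℝ) - s')| ≤ 1 / 2 := by
    rw [habs]
    nlinarith
  have hint : α * ((s : ℝ) - s') - (E - E') = ((N' - N : ℤ) : ℝ) := by
    push_cast
    linarith
  -- The two counts turn the circle by the same amount up to `1 / 16`, and by less than one turn.
  have hN : N' - N = 0 := by
    have h := abs_le.mp hαs
    have h1 : ((N' - N : ℤ) : ℝ) < 1 := by rw [← hint]; linarith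
    have h2 : (-1 : ℝ) < ((N' - N : ℤ) : ℝ) := by rw [← hint]; linarith
    have h1' : N' - N < 1 := by exact_mod_cast h1
    have h2' : -1 < N' - N := by exact_mod_cast h2
    omega
  have hsmall : α * |(s : ℝ) - s'| ≤ 1 / 16 := by
    rw [← habs, abs_le]
    rw [hN, Int.cast_zero] at hint
    constructor <;> linarith
  have : 2 * |(s : ℝ) - s'| ≤ 2 ^ j := by
    by_contra h
    nlinarith
  exact_mod_cast this

/-- The threshold at `T` of an input whose number of ones has `|2 (s - T) + 1| < 2 ^ j` is computed
by `j` rounds. Each round either decides the threshold or halves the range. -/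
theorem exists_layers_threshold {n : ℕ} (t : Fin n) (T : ℤ) (r : ℕ) (v : Fin (17 * (r + 1)))
    (hv : (v : ℕ) = 0) (j : ℕ) (hj : j + 1 ≤ r) :
    ∃ Ls : List (PBPLayer n (17 * (r + 1))),
      Ls.length = j * (2 * (r + 1) * n + 17 * (r + 1)) ∧
      ∀ x : Fin n → Bool, |2 * ((onesCount x : ℤ) - T) + 1| < 2 ^ j →
        runLayers Ls x (Sum.inl v) = Sum.inr (decide (T ≤ onesCount x)) := by
  classical
  induction j with
  | zero =>
    -- The odd number `2 * (s - T) + 1` is not zero, so no input is left.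
    refine ⟨[], by simp, fun x hx => ?_⟩
    rw [pow_zero, abs_lt] at hx
    omega
  | succ j ih =>
    obtain ⟨Ls, hlen, hLs⟩ := ih (by omega)
    obtain ⟨ps, hps, hsep⟩ := exists_separating_sweeps r j (by omega) v hv
    -- `far b w`: the node `w` is the end point of a count in the outer half of the range, on the
    -- side `b` of the threshold.
    let far (b : Bool) (w : Fin (17 * (r + 1))) : Prop :=
      ∃ s : ℕ, |2 * ((s : ℤ) - T) + 1| < 2 ^ (j + 1) ∧ 2 ^ j ≤ |2 * ((s : ℤ) - T) + 1| ∧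
        decide (T ≤ s) = b ∧ sweepEnd ps s v = w
    let f (w : Fin (17 * (r + 1))) : Option Bool :=
      if far true w then some true else if far false w then some false else none
    refine ⟨sweeps n ps ++ (List.finRange _).map (exitLayer t f) ++
        sweeps n (ps.map (·⁻¹)).reverse ++ Ls, ?_, fun x hx => ?_⟩
    · simp only [List.length_append, length_sweeps, List.length_map, List.length_reverse,
        List.length_finRange, hps, hlen]
      ring
    · rw [runLayers_append, runLayers_round]
      -- Counts with the same end point as a far one lie on the same side of the threshold.
      have hfar (b : Bool) (h : far b (sweepEnd ps (onesCount x) v)) :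
          decide (T ≤ onesCount x) = b := by
        obtain ⟨s, hs1, hs2, rfl, hs3⟩ := h
        have h2 := hsep (onesCount x) s (by
          rw [pow_succ] at hx hs1
          rw [abs_lt] at *
          omega) hs3.symm
        rw [decide_eq_decide]
        generalize (2 : ℤ) ^ j = B at h2 hs2
        rw [le_abs] at hs2
        have h3 := abs_le.mp (show |((onesCount x : ℤ)) - s| ≤ B / 2 by omega)
        omega
      by_cases h1 : far true (sweepEnd ps (onesCount x) v)
      · simp only [f, h1, if_true, Option.elim]
        rw [runLayers_inr, hfar true h1]
      by_cases h0 : far false (sweepEnd ps (onesCount x) v)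
      · simp only [f, h1, h0, if_true, if_false, Option.elim]
        rw [runLayers_inr, hfar false h0]
      simp only [f, h1, h0, if_false, Option.elim]
      refine hLs x (lt_of_not_ge fun hge => ?_)
      cases hb : decide (T ≤ onesCount x)
      · exact h0 ⟨onesCount x, hx, hge, hb, rfl⟩
      · exact h1 ⟨onesCount x, hx, hge, hb, rfl⟩

/-! ### Majority -/

theorem onesCount_le {n : ℕ} (x : Fin n → Bool) : onesCount x ≤ n := by
  simpa [onesCount] using List.countP_le_length (p := x) (l := List.finRange n)

theorem sum_ite_eq_onesCount {n : ℕ} (x : Fin n → Bool) :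
    (∑ i, if x i then (1 : ℚ) else 0) = onesCount x := by
  have h (l : List (Fin n)) :
      (l.map fun i => if x i then (1 : ℚ) else 0).sum = (l.countP x : ℕ) := by
    induction l with
    | nil => simp
    | cons a l ih =>
      rw [List.map_cons, List.sum_cons, ih]
      cases hx : x a <;> simp [hx, add_comm]
  rw [onesCount, ← h, ← List.ofFn_eq_map, List.sum_ofFn]

theorem majority_eq_decide {n : ℕ} (x : Fin n → Bool) :
    majority n x = decide ((((n + 1) / 2 : ℕ) : ℤ) ≤ onesCount x) := by
  rw [majority, sum_ite_eq_onesCount, decide_eq_decide, div_le_iff₀ two_pos]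
  norm_cast
  omega

theorem exists_permBP_majority (n : ℕ) (hn : 2 ≤ n) :
    ∃ P : PermBP n, P.Computes (majority n) ∧ P.size ≤ 20000 * (n * Nat.clog 2 n ^ 3) := by
  set J := Nat.clog 2 n with hJ
  have hnJ : n ≤ 2 ^ J := Nat.le_pow_clog one_lt_two n
  have hJ1 : 1 ≤ J := Nat.clog_pos one_lt_two hn
  let v : Fin (17 * (J + 2 + 1)) := ⟨0, by omega⟩
  obtain ⟨Ls, hlen, hLs⟩ :=
    exists_layers_threshold (⟨0, by omega⟩ : Fin n) ((n + 1) / 2 : ℕ) (J + 2) v rfl (J + 1) le_rfl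
  refine ⟨⟨17 * (J + 2 + 1), ⟨0, by omega⟩, fun _ => Sum.inl v, Ls⟩, fun x => ?_, ?_⟩
  · rw [majority_eq_decide]
    refine hLs x ?_
    have h1 := onesCount_le x
    have h2 : (n : ℤ) ≤ 2 ^ J := by exact_mod_cast hnJ
    rw [abs_lt, pow_succ]
    omega
  · change 1 + (Ls.length + 1) * (17 * (J + 2 + 1)) + 2 ≤ _
    rw [hlen]
    have hJn : 1 ≤ J ^ 2 * n := Nat.mul_pos (by positivity) (by omega)
    have hk : J + 2 + 1 ≤ 4 * J := by omega
    have h1 : 2 * (J + 2 + 1) * n + 17 * (J + 2 + 1) ≤ 76 * (J * n) := by nlinarith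
    have h2 : (J + 1) * (2 * (J + 2 + 1) * n + 17 * (J + 2 + 1)) + 1 ≤ 153 * (J ^ 2 * n) := by
      nlinarith [Nat.mul_le_mul (by omega : J + 1 ≤ 2 * J) h1]
    have h3 := Nat.mul_le_mul h2 (Nat.mul_le_mul_left 17 hk)
    have h4 : 1 ≤ J ^ 3 * n := Nat.mul_pos (by positivity) (by omega)
    nlinarith

theorem clog_two_le_log (n : ℕ) (hn : 2 ≤ n) : (Nat.clog 2 n : ℝ) ≤ 3 * Real.log n := by
  set J := Nat.clog 2 n with hJ
  have hJ1 : 1 ≤ J := Nat.clog_pos one_lt_two hn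
  have hlt : 2 ^ (J - 1) < n := Nat.pow_pred_clog_lt_self one_lt_two hn
  have h1 : ((J - 1 : ℕ) : ℝ) * Real.log 2 ≤ Real.log n := by
    rw [← Real.log_pow]
    exact Real.log_le_log (by positivity) (by exact_mod_cast hlt.le)
  have h2 : Real.log 2 ≤ Real.log n := Real.log_le_log two_pos (by exact_mod_cast hn)
  rw [Nat.cast_sub hJ1, Nat.cast_one] at h1
  have h3 := Real.log_two_gt_d9
  have h4 : (0 : ℝ) ≤ J := J.cast_nonneg
  nlinarith

theorem mainTheorem3 :
    ∃ C : ℝ, 0 < C ∧ ∀ n : ℕ, 2 ≤ n →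
      ∃ s : ℕ, pbpComplexity (majority n) = (s : ℕ∞) ∧
        (s : ℝ) ≤ C * ((n : ℝ) * Real.log n ^ 3) := by
  refine ⟨20000 * 27, by norm_num, fun n hn => ?_⟩
  obtain ⟨P, hP, hsize⟩ := exists_permBP_majority n hn
  have hle : pbpComplexity (majority n) ≤ (P.size : ℕ∞) := iInf₂_le P hP
  obtain ⟨s, hs⟩ := ENat.ne_top_iff_exists.mp (ne_top_of_le_ne_top (ENat.natCast_ne_top _) hle)
  refine ⟨s, hs.symm, ?_⟩
  rw [← hs] at hle
  have hsP : s ≤ 20000 * (n * Nat.clog 2 n ^ 3) := (Nat.cast_le.mp hle).trans hsize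
  calc (s : ℝ) ≤ 20000 * (n * (Nat.clog 2 n : ℝ) ^ 3) := by exact_mod_cast hsP
    _ ≤ 20000 * (n * (3 * Real.log n) ^ 3) := by
        gcongr
        exact clog_two_le_log n hn
    _ = 20000 * 27 * (n * Real.log n ^ 3) := by ring
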